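/- Let $N$ be a finite set of $n\ge 2$ voters, partitioned into groups $(N_q)_{q\in G}$, and let $P=\{p_1,\dots,p_m\}$ be a set of projects ordered by $p_1\triangleleft\dots\triangleleft p_m$. Write $\trianglelefteq$ for the reflexive closure of $\triangleleft$, $[p_1,p_t]=\{p_1,\dots,p_t\}$ and $[p_1,p_0]=\emptyset$. A strict linear order $\succ$ on $P$ with top-ranked project $\succ(1)$ is single-peaked if $p\succ p'$ whenever $\succ(1)\triangleleft p\triangleleft p'$ or $p'\triangleleft p\triangleleft\succ(1)$. Let $\mathcal D$ be the set of all single-peaked preferences and $\Delta P$ the set of probability distributions on $P$; for $\delta\in\Delta P$ and $A\subseteq P$ put $\delta(A)=\sum_{p\in A}\delta(p)$. A random social choice rule is a map $\varphi:\mathcal D^N\to\Delta P$; $\varphi_p(\mathcal P)$ is the probability of $p$ at the profile $\mathcal P=(\succ_i)_{i\in N}$, and $\mathcal P_{N_q}$ is the restriction of $\mathcal P$ to $N_q$. The rule $\varphi$ is - unanimous if $\varphi_p(\mathcal P)=1$ whenever $\succ_i(1)=p$ for all $i\in N$; - strategy-proof if for every profile $\mathcal P$, voter $i$, $\succ_i'\in\mathcal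 D$ and $p\in P$, the set $U=\{p\}\cup\{p': p'\succ_i p\}$ has at least as large a probability under $\varphi(\mathcal P)$ as under $\varphi(\succ_i',\succ_{-i})$; - group-wise anonymous if $\varphi\big((\succ_{\pi(i)})_{i\in N}\big)=\varphi\big((\succ_i)_{i\in N}\big)$ for every permutation $\pi$ of $N$ that maps each $N_q$ to itself. For each $q\in G$ let $\kappa_q\in\{1,\dots,m\}$, $\eta_q\in[0,1]$ and $\psi_q:\mathcal D^{N_q}\to 2^P$. Assume that $\psi_G=(\psi_q)_{q\in G}$ is compliant with $\kappa_G=(\kappa_q)_{q\in G}$: for every $q$ and every $\mathcal Q\in\mathcal D^{N_q}$, the set $\psi_q(\mathcal Q)$ is an interval of exactly $\kappa_q$ consecutive projects and contains a project $p$ with $\succ_i(1)\trianglelefteq p\trianglelefteq\succ_j(1)$ for some $i,j\in N_q$. The rule $\varphi$ satisfies $(\kappa_G,\psi_G,\eta_G)$-strong-GEG if for every profile $\mathcal P$ and every $q$ there is $p\in\psi_q(\mathcal P_{N_q})$ with $\varphi_p(\mathcal P)\ge\eta_q$. Let $\Gamma=\prod_{q\in G}\{0,\dots,|N_q|\}$,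 and write $\gamma\gg\gamma'$ if $\gamma_q\ge\gamma'_q$ for all $q$. For $0\le t\le m$ let $\alpha(t;\mathcal P)\in\Gamma$ be the vector whose $q$-th entry is the number of $i\in N_q$ with $\succ_i(1)\in[p_1,p_t]$. The rule $\varphi$ is the probabilistic fixed group ballot rule with ballots $(\delta_\gamma)_{\gamma\in\Gamma}$, $\delta_\gamma\in\Delta P$, if 1. $\delta_{(0,\dots,0)}(p_m)=1$ and $\delta_{(|N_q|)_q}(p_1)=1$; 2. $\gamma\gg\gamma'$ implies $\delta_\gamma([p_1,p_t])\ge\delta_{\gamma'}([p_1,p_t])$ for all $1\le t\le m$; 3. $\varphi_{p_t}(\mathcal P)=\delta_{\alpha(t;\mathcal P)}([p_1,p_t])-\delta_{\alpha(t-1;\mathcal P)}([p_1,p_{t-1}])$ for all $\mathcal P\in\mathcal D^N$ and $1\le t\le m$. Projects $p_x,\dots,p_{x+k-1}$ (with $1\le x$ and $x+k-1\le m$) are feasible at $(z_0,\dots,z_k;\psi_q)$ if there is $\mathcal Q\in\mathcal D^{N_q}$ such that $p_x=\min\psi_q(\mathcal Q)$, exactly $z_0$ voters of $N_q$ have their top-ranked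 project strictly before $p_x$, and for each $1\le j\le k$ exactly $z_j$ voters of $N_q$ have their top-ranked project at or before $p_{x+j-1}$. **Theorem.** A random social choice rule $\varphi:\mathcal D^N\to\Delta P$ is unanimous, strategy-proof, group-wise anonymous and satisfies $(\kappa_G,\psi_G,\eta_G)$-strong-GEG if and only if it is a probabilistic fixed group ballot rule, with ballots $(\delta_\gamma)_{\gamma\in\Gamma}$, such that for all $q\in G$, all $\gamma^0,\dots,\gamma^{\kappa_q}\in\Gamma$ with $\gamma^{\kappa_q}\gg\dots\gg\gamma^1\gg\gamma^0$, and all $p_x\in P$ such that $\{p_x,\dots,p_{x+\kappa_q-1}\}$ is feasible at $(\gamma^0_q,\dots,\gamma^{\kappa_q}_q;\psi_q)$, there is $t\in\{0,\dots,\kappa_q-1\}$ with $$\delta_{\gamma^{t+1}}([p_1,p_{x+t}])-\delta_{\gamma^t}([p_1,p_{x+t-1}])\ge\eta_q .$$ -/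

import Mathlib

/-!
Projects are `p_1 ◁ ⋯ ◁ p_m`, modelled by `Fin m` with its usual order; the element of value `k`
is the project `p_{k+1}`.  Voters form a finite type `V`, group labels a finite type `G`, and the
partition `(N_q)_{q ∈ G}` of the voters is the map `grp : V → G`, with `N_q = {i | grp i = q}`.
-/

namespace GroupFair

open Finset

/-- A strict ordinal preference on the projects: a complete, reflexive, antisymmetric and
transitive relation; `r p p'` reads "`p` is at least as good as `p'`". -/
structure Pref (m : ℕ) where
  r : Fin m → Fin m → Prop
  refl : ∀ p, r p p
  antisymm : ∀ p p', r p p' → r p' p → p = p'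
  trans : ∀ p p' p'', r p p' → r p' p'' → r p p''
  total : ∀ p p', r p p' ∨ r p' p

/-- `p ≻ p'`: `p` is strictly preferred to `p'`. -/
def Pref.Strict {m : ℕ} (R : Pref m) (p p' : Fin m) : Prop := R.r p p' ∧ p ≠ p'

theorem Pref.exists_top {m : ℕ} [NeZero m] (R : Pref m) : ∃ p, ∀ p', ¬ R.Strict p' p := by
  have key : ∀ s : Finset (Fin m), s.Nonempty → ∃ p ∈ s, ∀ p' ∈ s, R.r p p' := by
    intro s hs
    induction hs using Finset.Nonempty.cons_induction with
    | singleton a =>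
      exact ⟨a, by simp, fun p' hp' => by rw [Finset.mem_singleton.1 hp']; exact R.refl a⟩
    | cons a s ha hs ih =>
      obtain ⟨b, hb, hbs⟩ := ih
      rcases R.total a b with h | h
      · refine ⟨a, by simp, fun p' hp' => ?_⟩
        rcases Finset.mem_cons.1 hp' with rfl | hp'
        · exact R.refl _
        · exact R.trans _ _ _ h (hbs p' hp')
      · refine ⟨b, by simp [hb], fun p' hp' => ?_⟩
        rcases Finset.mem_cons.1 hp' with rfl | hp'
        · exact h
        · exact hbs p' hp'
  obtain ⟨p, -, hp⟩ := key univ ⟨0, mem_univ _⟩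
  exact ⟨p, fun p' h => h.2 (R.antisymm _ _ h.1 (hp p' (mem_univ _)))⟩

/-- The top-ranked project. -/
noncomputable def Pref.top {m : ℕ} [NeZero m] (R : Pref m) : Fin m := R.exists_top.choose

theorem Pref.top_spec {m : ℕ} [NeZero m] (R : Pref m) (p : Fin m) : ¬ R.Strict p R.top :=
  R.exists_top.choose_spec p

/-- Single-peakedness with respect to the order of the projects. -/
def Pref.SinglePeaked {m : ℕ} [NeZero m] (R : Pref m) : Prop :=
  ∀ p p' : Fin m, (R.top < p ∧ p < p') ∨ (p' < p ∧ p < R.top) → R.Strict p p'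

/-- The domain `𝒟` of all single-peaked preferences. -/
abbrev SPPref (m : ℕ) [NeZero m] := {R : Pref m // R.SinglePeaked}

/-- The top-ranked project of a single-peaked preference. -/
noncomputable def SPPref.peak {m : ℕ} [NeZero m] (R : SPPref m) : Fin m := R.1.top

/-- Probability distributions over the projects. -/
abbrev Lottery (m : ℕ) := stdSimplex ℝ (Fin m)

/-- A random social choice rule `φ : 𝒟^n → ΔP`. -/
abbrev RSCR (V : Type*) (m : ℕ) [NeZero m] := (V → SPPref m) → Lottery m

open Classical in
/-- Probability of the upper contour set `U(p, ≻)`. -/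
noncomputable def upperProb {m : ℕ} [NeZero m] (R : SPPref m) (d : Lottery m) (p : Fin m) : ℝ :=
  ∑ p' with R.1.r p' p, d.1 p'

/-- `d` stochastically dominates `d'` with respect to `R`. -/
def StochDom {m : ℕ} [NeZero m] (R : SPPref m) (d d' : Lottery m) : Prop :=
  ∀ p, upperProb R d' p ≤ upperProb R d p

def Unanimous {V : Type*} {m : ℕ} [NeZero m] (φ : RSCR V m) : Prop :=
  ∀ (p : Fin m) (P : V → SPPref m), (∀ i, (P i).peak = p) → (φ P).1 p = 1

def StrategyProof {V : Type*} [DecidableEq V] {m : ℕ} [NeZero m] (φ : RSCR V m) : Prop :=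
  ∀ (i : V) (P : V → SPPref m) (R' : SPPref m),
    StochDom (P i) (φ P) (φ (Function.update P i R'))

/-- Invariance under permutations of the voters that map each group to itself. -/
def GroupAnonymous {V G : Type*} (grp : V → G) {m : ℕ} [NeZero m] (φ : RSCR V m) : Prop :=
  ∀ π : Equiv.Perm V, (∀ i, grp (π i) = grp i) →
    ∀ P : V → SPPref m, φ P = φ (fun i => P (π i))

/-- The members of the group `N_q`. -/
abbrev Members {V G : Type*} (grp : V → G) (q : G) := {i : V // grp i = q}

/-- The restriction of a profile to the group `N_q`. -/
def restrict {V G : Type*} (grp : V → G) {m : ℕ} [NeZero m] (P : V → SPPref m) (q : G) :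
    Members grp q → SPPref m := fun i => P i.1

/-- A representation scenario: for each group, a function from the profiles of the group to sets
of projects. -/
abbrev RepScenario {V G : Type*} (grp : V → G) (m : ℕ) [NeZero m] :=
  (q : G) → (Members grp q → SPPref m) → Finset (Fin m)

/-- Some representative project lies between the top-ranked projects of two members. -/
def TopRanged {W : Type*} {m : ℕ} [NeZero m] (ψ : (W → SPPref m) → Finset (Fin m)) : Prop :=
  ∀ Q : W → SPPref m, ∃ p ∈ ψ Q, ∃ i j : W, (Q i).peak ≤ p ∧ p ≤ (Q j).peak

/-- The scenario is compliant with `κ`: each function is top-ranged and selects an interval of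
exactly `κ q` projects. -/
def Compliant {V G : Type*} (grp : V → G) {m : ℕ} [NeZero m] (κ : G → ℕ)
    (ψ : RepScenario grp m) : Prop :=
  ∀ q, TopRanged (ψ q) ∧ ∀ Q, (∃ a b, ψ q Q = Finset.Icc a b) ∧ (ψ q Q).card = κ q

/-- `(κ, ψ, η)`-strong group entitlement guarantee. -/
def StrongGEG {V G : Type*} (grp : V → G) {m : ℕ} [NeZero m] (ψ : RepScenario grp m)
    (η : G → ℝ) (φ : RSCR V m) : Prop :=
  ∀ (P : V → SPPref m) (q : G), ∃ p ∈ ψ q (restrict grp P q), η q ≤ (φ P).1 p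

/-- The number of voters whose top-ranked project is among `p_1, …, p_t`. -/
noncomputable def countUpTo {W : Type*} [Fintype W] {m : ℕ} [NeZero m] (t : ℕ)
    (Q : W → SPPref m) : ℕ :=
  #{i : W | ((Q i).peak : ℕ) < t}

/-- The set `Γ` of vectors `γ` with `0 ≤ γ_q ≤ |N_q|`.  Its componentwise order is domination:
`γ' ≤ γ` means `γ ≫ γ'`. -/
abbrev Gam {V G : Type*} [Fintype V] [DecidableEq G] (grp : V → G) :=
  {γ : G → ℕ // ∀ q, γ q ≤ Fintype.card (Members grp q)}

/-- The zero vector of `Γ`. -/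
def gamBot {V G : Type*} [Fintype V] [DecidableEq G] (grp : V → G) : Gam grp :=
  ⟨fun _ => 0, fun _ => Nat.zero_le _⟩

/-- The vector `(|N_q|)_q` of `Γ`. -/
def gamTop {V G : Type*} [Fintype V] [DecidableEq G] (grp : V → G) : Gam grp :=
  ⟨fun q => Fintype.card (Members grp q), fun _ => le_rfl⟩

/-- `α(t; P)`: for each group, the number of its members whose peak is among `p_1, …, p_t`. -/
noncomputable def alpha {V G : Type*} [Fintype V] [DecidableEq G] (grp : V → G) {m : ℕ} [NeZero m]
    (t : ℕ) (P : V → SPPref m) : Gam grp :=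
  ⟨fun q => countUpTo t (restrict grp P q), fun _ => Finset.card_le_univ _⟩

/-- `d([p_1, p_t])`, which is `0` for `t = 0`. -/
noncomputable def cum {m : ℕ} (d : Lottery m) (t : ℕ) : ℝ :=
  ∑ p ∈ ({p : Fin m | (p : ℕ) < t} : Finset (Fin m)), d.1 p

/-- `φ` is the probabilistic fixed group ballot rule with the probabilistic ballots `δ`. -/
structure IsPFGBRWith {V G : Type*} [Fintype V] [DecidableEq G] (grp : V → G) {m : ℕ} [NeZero m]
    (φ : RSCR V m) (δ : Gam grp → Lottery m) : Prop where
  unanimity_bot : ∀ p : Fin m, (p : ℕ) + 1 = m → (δ (gamBot grp)).1 p = 1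
  unanimity_top : ∀ p : Fin m, (p : ℕ) = 0 → (δ (gamTop grp)).1 p = 1
  monotone : ∀ γ γ' : Gam grp, γ' ≤ γ → ∀ t : ℕ, 1 ≤ t → t ≤ m → cum (δ γ') t ≤ cum (δ γ) t
  /-- The probability of `p_t`, for `t = p + 1`. -/
  prob : ∀ (P : V → SPPref m) (p : Fin m),
    (φ P).1 p = cum (δ (alpha grp (p + 1) P)) (p + 1) - cum (δ (alpha grp p P)) p

/-- With `x` the project of that index, the `k` consecutive projects starting at `x` exist and are
feasible at `(z_0, …, z_k; ψ)`: for some profile of the group, `x` is the least representative,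
exactly `z_0` peaks lie strictly before `x`, and, for `1 ≤ j ≤ k`, exactly `z_j` peaks lie at or
before the `j`-th of these projects. -/
def Feasible {W : Type*} [Fintype W] {m : ℕ} [NeZero m] (ψ : (W → SPPref m) → Finset (Fin m))
    (k : ℕ) (x : Fin m) (z : Fin (k + 1) → ℕ) : Prop :=
  (x : ℕ) + k ≤ m ∧ ∃ Q : W → SPPref m, IsLeast (ψ Q : Set (Fin m)) x ∧
    ∀ j : Fin (k + 1), countUpTo ((x : ℕ) + j) Q = z j

end GroupFair

/-! Everything is read through the cumulative probabilities of initial segments `{p_1, …, p_t}`. The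
core is that unanimity and strategy-proofness force `cum (φ P) t` to depend only on which voters
have their peak in the segment.

Strategy-proofness fixes the mass of any set that is upper for both the old and the new report of a
voter. Hence, if a voter with peak `a` swaps adjacent `x < a < y`, only the masses of `x` and `y`
can change. The size of that change survives moving the other voters to peak `a`, one at a time,
through preferences sharing an upper set that separates `x` from `y`. Unanimity then makes it zero.
Such swaps link any preference to `leftFirst` of its peak, so only peaks matter
(`StrategyProof.update_eq_of_peak_eq`). Initial segments are upper for `leftFirst a` with `a`
inside, final segments for `rightFirst a`, which gives `StrategyProof.cum_eq`. Group anonymity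
reduces the dependence to `alpha`, and the ballots are the lotteries at profiles whose peaks are all
extreme (`StrategyProof.isPFGBRWith`).

Conversely, upper contour sets are intervals around the peak, and monotone ballots make a misreport
lower their mass. Finally, the probability of a project is exactly a ballot difference along the
path of peak counts, so the guarantee and the ballot inequality coincide once every relevant chain
is realised by a profile (`exists_profile_restrict_eq`). -/

namespace GroupFair

open Finset

/-! ### Lotteries, single-peaked orders and their upper sets -/

section Preferences

variable {m : ℕ}

theorem Pref.ext_of_imp {R R' : Pref m} (h : ∀ p q, R.r p q → R'.r p q) : R = R' := by
  have key : R.r = R'.r := by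
    funext p q
    refine propext ⟨h p q, fun hpq => ?_⟩
    rcases R.total p q with h1 | h1
    · exact h1
    · rw [R'.antisymm _ _ hpq (h _ _ h1)]
      exact R.refl _
  cases R; cases R'; cases key; rfl

/-- `A` is closed under passing to better projects. -/
def Pref.IsUpper (R : Pref m) (A : Finset (Fin m)) : Prop :=
  ∀ p ∈ A, ∀ p', R.r p' p → p' ∈ A

theorem Pref.exists_worst (R : Pref m) {s : Finset (Fin m)} (hs : s.Nonempty) :
    ∃ p ∈ s, ∀ p' ∈ s, R.r p' p := by
  induction hs using Finset.Nonempty.cons_induction with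
  | singleton a =>
    exact ⟨a, by simp, fun p' hp' => by rw [Finset.mem_singleton.1 hp']; exact R.refl a⟩
  | cons a s ha hs ih =>
    obtain ⟨b, hb, hbs⟩ := ih
    rcases R.total b a with h | h
    · refine ⟨a, by simp, fun p' hp' => ?_⟩
      rcases Finset.mem_cons.1 hp' with rfl | hp'
      · exact R.refl _
      · exact R.trans _ _ _ (hbs p' hp') h
    · refine ⟨b, by simp [hb], fun p' hp' => ?_⟩
      rcases Finset.mem_cons.1 hp' with rfl | hp'
      · exact h
      · exact hbs p' hp'

theorem Lottery.sum_eq_one (d : Lottery m) : ∑ p, d.1 p = 1 := d.2.2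

theorem Lottery.eq_zero_of_eq_one {d : Lottery m} {a p : Fin m} (h : d.1 a = 1) (hp : p ≠ a) :
    d.1 p = 0 := by
  have h1 := Lottery.sum_eq_one d
  rw [← Finset.add_sum_erase univ _ (mem_univ a), h] at h1
  have h2 : ∑ x ∈ univ.erase a, d.1 x = 0 := by linarith
  exact (Finset.sum_eq_zero_iff_of_nonneg fun i _ => d.2.1 i).1 h2 p (by simp [hp])

theorem cum_zero (d : Lottery m) : cum d 0 = 0 := by simp [cum]

theorem cum_of_le (d : Lottery m) {t : ℕ} (h : m ≤ t) : cum d t = 1 := by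
  rw [← Lottery.sum_eq_one d, cum]
  congr 1
  ext p
  simp [p.2.trans_le h]

theorem cum_succ (d : Lottery m) (p : Fin m) : cum d (p + 1) = cum d p + d.1 p := by
  unfold cum
  rw [add_comm (Finset.sum _ _), ← Finset.sum_insert (by simp)]
  congr 1
  ext q
  simp only [mem_filter, mem_univ, true_and, mem_insert, Fin.ext_iff]
  omega

theorem cum_add_compl (d : Lottery m) (t : ℕ) :
    cum d t + ∑ p ∈ ({p : Fin m | ¬ (p : ℕ) < t} : Finset (Fin m)), d.1 p = 1 := by
  rw [cum, Finset.sum_filter_add_sum_filter_not, Lottery.sum_eq_one d]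

theorem Pref.exists_min_contour (R : Pref m) (x : Fin m) :
    ∃ u, R.r u x ∧ ∀ p, R.r p x → u ≤ p := by
  classical
  have hne : ({p | R.r p x} : Finset (Fin m)).Nonempty := ⟨x, by simp [R.refl]⟩
  exact ⟨_, (mem_filter.1 (Finset.min'_mem _ hne)).2,
    fun p hp => Finset.min'_le _ _ (by simpa using hp)⟩

theorem Pref.exists_max_contour (R : Pref m) (x : Fin m) :
    ∃ u, R.r u x ∧ ∀ p, R.r p x → p ≤ u := by
  classical
  have hne : ({p | R.r p x} : Finset (Fin m)).Nonempty := ⟨x, by simp [R.refl]⟩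
  exact ⟨_, (mem_filter.1 (Finset.max'_mem _ hne)).2,
    fun p hp => Finset.le_max' _ _ (by simpa using hp)⟩

/-- The change of the probability mass of a set that separates `x` from `y` does not depend on the
set. -/
theorem sum_sub_sum_of_eq_off {d d' : Fin m → ℝ} {x y : Fin m} {W : Finset (Fin m)}
    (h : ∀ p, p ≠ x → p ≠ y → d' p = d p) (hx : x ∈ W) (hy : y ∉ W) :
    ∑ p ∈ W, d p - ∑ p ∈ W, d' p = d x - d' x := by
  rw [← Finset.add_sum_erase W d hx, ← Finset.add_sum_erase W d' hx]
  have : ∑ p ∈ W.erase x, d' p = ∑ p ∈ W.erase x, d p := by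
    refine Finset.sum_congr rfl fun p hp => h p (Finset.ne_of_mem_erase hp) ?_
    rintro rfl
    exact hy (Finset.mem_of_mem_erase hp)
  rw [this]; ring

theorem sub_add_sub_of_eq_off {d d' : Lottery m} {x y : Fin m} (hxy : x ≠ y)
    (h : ∀ p, p ≠ x → p ≠ y → d'.1 p = d.1 p) :
    (d.1 x - d'.1 x) + (d.1 y - d'.1 y) = 0 := by
  have h1 := sum_sub_sum_of_eq_off (W := univ.erase y) h (by simp [hxy]) (by simp)
  have h2 := Lottery.sum_eq_one d
  have h3 := Lottery.sum_eq_one d'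
  rw [← Finset.add_sum_erase univ _ (mem_univ y)] at h2 h3
  linarith

variable [NeZero m]

theorem Pref.top_le (R : Pref m) (p : Fin m) : R.r R.top p := by
  rcases R.total R.top p with h | h
  · exact h
  · by_cases hp : p = R.top
    · rw [hp]; exact R.refl _
    · exact absurd ⟨h, hp⟩ (R.top_spec p)

theorem Pref.top_eq (R : Pref m) {a : Fin m} (h : ∀ p, R.r a p) : R.top = a :=
  R.antisymm _ _ (R.top_le a) (h _)

theorem SPPref.peak_le (R : SPPref m) (p : Fin m) : R.1.r R.peak p := R.1.top_le p

theorem SPPref.r_of_lt {R : SPPref m} {p q : Fin m}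
    (h : (R.peak ≤ p ∧ p ≤ q) ∨ (q ≤ p ∧ p ≤ R.peak)) : R.1.r p q := by
  rcases eq_or_ne p R.peak with rfl | h1
  · exact R.peak_le _
  rcases eq_or_ne p q with rfl | h2
  · exact R.1.refl _
  refine (R.2 p q ?_).1
  rcases h with ⟨h3, h4⟩ | ⟨h3, h4⟩
  · exact Or.inl ⟨lt_of_le_of_ne h3 h1.symm, lt_of_le_of_ne h4 h2⟩
  · exact Or.inr ⟨lt_of_le_of_ne h3 h2.symm, lt_of_le_of_ne h4 h1⟩

/-- Upper contour sets are intervals, because `b` lies between the peak and one of `a`, `c`. -/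
theorem SPPref.r_of_between (R : SPPref m) {a b c q : Fin m} (ha : R.1.r a q) (hc : R.1.r c q)
    (hab : a ≤ b) (hbc : b ≤ c) : R.1.r b q := by
  rcases le_total R.peak b with h | h
  · exact R.1.trans _ _ _ (r_of_lt (Or.inl ⟨h, hbc⟩)) hc
  · exact R.1.trans _ _ _ (r_of_lt (Or.inr ⟨hab, h⟩)) ha

/-- The preference that ranks the projects by increasing values of an injective cost. -/
def Pref.ofCost (f : Fin m → ℤ) (hf : Function.Injective f) : Pref m where
  r p q := f p ≤ f q
  refl _ := le_rfl
  antisymm _ _ h h' := hf (le_antisymm h h')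
  trans _ _ _ := le_trans
  total _ _ := le_total _ _

/-- The preference with peak `a` that ranks the projects before `a` above those after `a`. -/
def leftFirst (a : Fin m) : SPPref m :=
  ⟨Pref.ofCost (fun p => if (p : ℕ) ≤ a then (a : ℤ) - p else p) (fun p q h => by
      ext; simp only at h; split_ifs at h <;> omega), by
    have ht : (Pref.ofCost (fun p : Fin m => if (p : ℕ) ≤ a then (a : ℤ) - p else p)
        (fun p q h => by ext; simp only at h; split_ifs at h <;> omega)).top = a := by
      refine Pref.top_eq _ fun p => ?_
      simp only [Pref.ofCost]; split_ifs <;> omega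
    intro p q h
    rw [ht] at h
    simp only [Fin.lt_def] at h
    refine ⟨?_, by rintro rfl; omega⟩
    simp only [Pref.ofCost]; split_ifs <;> omega⟩

/-- The preference with peak `a` that ranks the projects after `a` above those before `a`. -/
def rightFirst (a : Fin m) : SPPref m :=
  ⟨Pref.ofCost (fun p => if (a : ℕ) ≤ p then (p : ℤ) - a else (m : ℤ) - p) (fun p q h => by
      ext; simp only at h; split_ifs at h <;> omega), by
    have ht : (Pref.ofCost (fun p : Fin m => if (a : ℕ) ≤ p then (p : ℤ) - a else (m : ℤ) - p)
        (fun p q h => by ext; simp only at h; split_ifs at h <;> omega)).top = a := by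
      refine Pref.top_eq _ fun p => ?_
      simp only [Pref.ofCost]; split_ifs <;> omega
    intro p q h
    rw [ht] at h
    simp only [Fin.lt_def] at h
    refine ⟨?_, by rintro rfl; omega⟩
    simp only [Pref.ofCost]; split_ifs <;> omega⟩

theorem leftFirst_r {a p q : Fin m} : (leftFirst a).1.r p q ↔
    (q ≤ p ∧ p ≤ a) ∨ (p ≤ a ∧ a < q) ∨ (a < p ∧ p ≤ q) := by
  simp only [leftFirst, Pref.ofCost, Fin.le_def, Fin.lt_def]
  split_ifs <;> omega

theorem rightFirst_r {a p q : Fin m} : (rightFirst a).1.r p q ↔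
    (a ≤ p ∧ p ≤ q) ∨ (a ≤ p ∧ q < a) ∨ (q ≤ p ∧ p < a) := by
  simp only [rightFirst, Pref.ofCost, Fin.le_def, Fin.lt_def]
  split_ifs <;> omega

theorem peak_leftFirst (a : Fin m) : (leftFirst a).peak = a := by
  refine Pref.top_eq _ fun p => ?_
  rw [leftFirst_r]
  rcases lt_or_ge a p with h | h <;> simp [h]

theorem peak_rightFirst (a : Fin m) : (rightFirst a).peak = a := by
  refine Pref.top_eq _ fun p => ?_
  rw [rightFirst_r]
  rcases le_or_gt a p with h | h <;> simp [h]

theorem leftFirst_isUpper {v : Fin m} {A : Finset (Fin m)} (hv : ∀ p ∈ A, p ≤ v)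
    (h : ∀ p ∈ A, ∀ s, p ≤ s → s ≤ v → s ∈ A) : (leftFirst v).1.IsUpper A := by
  intro p hp s hs
  have := hv p hp
  rw [leftFirst_r] at hs
  simp only [Fin.le_def, Fin.lt_def] at *
  exact h p hp s (by omega) (by omega)

theorem rightFirst_isUpper {u : Fin m} {A : Finset (Fin m)} (hu : ∀ p ∈ A, u ≤ p)
    (h : ∀ p ∈ A, ∀ s, u ≤ s → s ≤ p → s ∈ A) : (rightFirst u).1.IsUpper A := by
  intro p hp s hs
  have := hu p hp
  rw [rightFirst_r] at hs
  simp only [Fin.le_def, Fin.lt_def] at *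
  exact h p hp s (by omega) (by omega)

theorem leftFirst_isUpper_Icc (a v : Fin m) : (leftFirst v).1.IsUpper (Icc a v) :=
  leftFirst_isUpper (fun _ h => (mem_Icc.1 h).2)
    fun _ h _ h1 h2 => mem_Icc.2 ⟨(mem_Icc.1 h).1.trans h1, h2⟩

theorem rightFirst_isUpper_Icc (u a : Fin m) : (rightFirst u).1.IsUpper (Icc u a) :=
  rightFirst_isUpper (fun _ h => (mem_Icc.1 h).1)
    fun _ h _ h1 h2 => mem_Icc.2 ⟨h1, h2.trans (mem_Icc.1 h).2⟩

/-- A nonempty upper set is the upper contour set of its worst element. -/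
theorem StochDom.sum_le {R : SPPref m} {d d' : Lottery m} (h : StochDom R d d')
    {A : Finset (Fin m)} (hA : R.1.IsUpper A) : ∑ p ∈ A, d'.1 p ≤ ∑ p ∈ A, d.1 p := by
  classical
  rcases A.eq_empty_or_nonempty with rfl | hne
  · simp
  obtain ⟨w, hw, hw'⟩ := R.1.exists_worst hne
  have hAw : A = ({p' | R.1.r p' w} : Finset (Fin m)) := by
    ext p
    simp only [mem_filter, mem_univ, true_and]
    exact ⟨hw' p, hA w hw p⟩
  have := h w
  unfold upperProb at this
  convert this using 2

end Preferences

/-! ### The effect of swapping two projects on opposite sides of the peak -/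

section TopsOnly

variable {V : Type*} [DecidableEq V] {m : ℕ} [NeZero m] {φ : RSCR V m}

theorem StrategyProof.sum_le (hφ : StrategyProof φ) (P : V → SPPref m) (i : V)
    {R : SPPref m} (R' : SPPref m) {A : Finset (Fin m)} (hA : R.1.IsUpper A) :
    ∑ p ∈ A, (φ (Function.update P i R')).1 p ≤ ∑ p ∈ A, (φ (Function.update P i R)).1 p := by
  have h := hφ i (Function.update P i R) R'
  rw [Function.update_self, Function.update_idem] at h
  exact h.sum_le hA

theorem StrategyProof.sum_eq (hφ : StrategyProof φ) (P : V → SPPref m) (i : V)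
    {R R' : SPPref m} {A : Finset (Fin m)} (hA : R.1.IsUpper A) (hA' : R'.1.IsUpper A) :
    ∑ p ∈ A, (φ (Function.update P i R')).1 p = ∑ p ∈ A, (φ (Function.update P i R)).1 p :=
  le_antisymm (hφ.sum_le P i R' hA) (hφ.sum_le P i R hA')

/-- The two orders differ at most in the ranking of `x` and `y`. -/
def AgreeOff (R R' : Pref m) (x y : Fin m) : Prop :=
  ∀ p q, ¬ (p = x ∧ q = y) → ¬ (p = y ∧ q = x) → (R.r p q ↔ R'.r p q)

/-- The upper contour set of `p`, with and without `p` itself, is upper for both orders. Both masses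
are therefore fixed, and so is their difference. -/
theorem StrategyProof.eq_of_agreeOff (hφ : StrategyProof φ) (P : V → SPPref m) (i : V)
    {R R' : SPPref m} {x y : Fin m} (h : AgreeOff R.1 R'.1 x y) {p : Fin m} (hx : p ≠ x)
    (hy : p ≠ y) : (φ (Function.update P i R')).1 p = (φ (Function.update P i R)).1 p := by
  classical
  have hr : ∀ q, R.1.r q p ↔ R'.1.r q p := fun q =>
    h q p (fun h => hy h.2) (fun h => hx h.2)
  let A : Finset (Fin m) := {q | R.1.r q p ∧ q ≠ p}
  have key : ∀ S : SPPref m, (∀ q, R.1.r q p ↔ S.1.r q p) →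
      S.1.IsUpper A ∧ S.1.IsUpper (insert p A) := by
    intro S hS
    simp only [Pref.IsUpper, A, mem_insert, mem_filter, mem_univ, true_and, hS]
    refine ⟨fun q hq s hs => ⟨S.1.trans _ _ _ hs hq.1, ?_⟩, fun q hq s hs => ?_⟩
    · rintro rfl
      exact hq.2 (S.1.antisymm _ _ hq.1 hs)
    · by_cases hsp : s = p
      · exact Or.inl hsp
      · rcases hq with rfl | hq
        · exact Or.inr ⟨hs, hsp⟩
        · exact Or.inr ⟨S.1.trans _ _ _ hs hq.1, hsp⟩
  have h1 := key R fun _ => Iff.rfl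
  have h2 := key R' hr
  have e1 := hφ.sum_eq P i h1.1 h2.1
  have e2 := hφ.sum_eq P i h1.2 h2.2
  rw [Finset.sum_insert (by simp [A]), Finset.sum_insert (by simp [A])] at e2
  linarith

/-- A set that separates `x` from `y` and is upper for both `T` and `T'` carries over the effect
of voter `i`'s swap from `T` to `T'`. -/
theorem StrategyProof.swap_effect_eq (hφ : StrategyProof φ) (P : V → SPPref m) {i j : V}
    (hij : j ≠ i) {R R' : SPPref m} {x y : Fin m} (hxy : x ≠ y) (h : AgreeOff R.1 R'.1 x y)
    {T T' : SPPref m} {W : Finset (Fin m)} (hT : T.1.IsUpper W) (hT' : T'.1.IsUpper W)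
    (hW : (x ∈ W ∧ y ∉ W) ∨ (y ∈ W ∧ x ∉ W)) :
    (φ (Function.update (Function.update P j T) i R)).1 x
        - (φ (Function.update (Function.update P j T) i R')).1 x =
      (φ (Function.update (Function.update P j T') i R)).1 x
        - (φ (Function.update (Function.update P j T') i R')).1 x := by
  have off : ∀ S : SPPref m, ∀ p, p ≠ x → p ≠ y →
      (φ (Function.update (Function.update P j S) i R')).1 p =
        (φ (Function.update (Function.update P j S) i R)).1 p :=
    fun S p hx hy => hφ.eq_of_agreeOff _ i h hx hy
  have e : ∀ S : SPPref m,
      ∑ p ∈ W, (φ (Function.update (Function.update P j T') i S)).1 p =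
        ∑ p ∈ W, (φ (Function.update (Function.update P j T) i S)).1 p := by
    intro S
    rw [Function.update_comm hij, Function.update_comm hij]
    exact hφ.sum_eq _ j hT hT'
  have e1 := e R
  have e2 := e R'
  rcases hW with ⟨hx, hy⟩ | ⟨hy, hx⟩
  · rw [← sum_sub_sum_of_eq_off (off T) hx hy, ← sum_sub_sum_of_eq_off (off T') hx hy, e1, e2]
  -- Here `W` fixes the change at `y`; since total mass is one, the change at `x` is its negative.
  · have f1 := sum_sub_sum_of_eq_off (fun p hp hq => off T p hq hp) hy hx
    have f2 := sum_sub_sum_of_eq_off (fun p hp hq => off T' p hq hp) hy hx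
    have g1 := sub_add_sub_of_eq_off hxy (off T)
    have g2 := sub_add_sub_of_eq_off hxy (off T')
    linarith

/-- Voter `j` reaches peak `a` in two moves. If `j` prefers `x` to `y`, the contour set of `x` is an
interval with least element `u`, hence also upper for `rightFirst u`. From there `[u, a]`, which
contains `x` but not `y`, is upper for `leftFirst a` too. The other case is the mirror image. -/
theorem StrategyProof.exists_peak_swap_effect_eq (hφ : StrategyProof φ) (P : V → SPPref m)
    {i j : V} (hij : j ≠ i) {R R' : SPPref m} {x a y : Fin m} (hxa : x < a) (hay : a < y)
    (h : AgreeOff R.1 R'.1 x y) :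
    ∃ T : SPPref m, T.peak = a ∧
      (φ (Function.update (Function.update P j T) i R)).1 x
          - (φ (Function.update (Function.update P j T) i R')).1 x =
        (φ (Function.update P i R)).1 x - (φ (Function.update P i R')).1 x := by
  classical
  have hxy : x ≠ y := (hxa.trans hay).ne
  have contour : ∀ w, (P j).1.IsUpper ({p | (P j).1.r p w} : Finset (Fin m)) := by
    intro w p hp s hs
    simp only [mem_filter, mem_univ, true_and] at hp ⊢
    exact (P j).1.trans _ _ _ hs hp
  rcases (P j).1.total x y with hr | hr
  · have hyx : ¬ (P j).1.r y x := fun h' => hxy ((P j).1.antisymm _ _ hr h')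
    obtain ⟨u, huU, hmin⟩ := (P j).1.exists_min_contour x
    have h1 : (rightFirst u).1.IsUpper ({p | (P j).1.r p x} : Finset (Fin m)) :=
      rightFirst_isUpper (fun p hp => hmin p (mem_filter.1 hp).2) fun p hp s h1 h2 =>
        mem_filter.2 ⟨mem_univ _, (P j).r_of_between huU (mem_filter.1 hp).2 h1 h2⟩
    refine ⟨leftFirst a, peak_leftFirst a, ?_⟩
    rw [← hφ.swap_effect_eq P hij hxy h (rightFirst_isUpper_Icc u a) (leftFirst_isUpper_Icc u a)
        (Or.inl ⟨mem_Icc.2 ⟨hmin x ((P j).1.refl x), hxa.le⟩,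
          fun h' => absurd (mem_Icc.1 h').2 (not_le.2 hay)⟩),
      ← hφ.swap_effect_eq P hij hxy h (contour x) h1
        (Or.inl ⟨by simp [(P j).1.refl], by simpa using hyx⟩), Function.update_eq_self]
  · have hyx : ¬ (P j).1.r x y := fun h' => hxy ((P j).1.antisymm _ _ h' hr)
    obtain ⟨v, hvU, hmax⟩ := (P j).1.exists_max_contour y
    have h1 : (leftFirst v).1.IsUpper ({p | (P j).1.r p y} : Finset (Fin m)) :=
      leftFirst_isUpper (fun p hp => hmax p (mem_filter.1 hp).2) fun p hp s h1 h2 =>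
        mem_filter.2 ⟨mem_univ _, (P j).r_of_between (mem_filter.1 hp).2 hvU h1 h2⟩
    refine ⟨rightFirst a, peak_rightFirst a, ?_⟩
    rw [← hφ.swap_effect_eq P hij hxy h (leftFirst_isUpper_Icc a v) (rightFirst_isUpper_Icc a v)
        (Or.inr ⟨mem_Icc.2 ⟨hay.le, hmax y ((P j).1.refl y)⟩,
          fun h' => absurd (mem_Icc.1 h').1 (not_le.2 hxa)⟩),
      ← hφ.swap_effect_eq P hij hxy h (contour y) h1
        (Or.inr ⟨by simp [(P j).1.refl], by simpa using hyx⟩), Function.update_eq_self]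

theorem StrategyProof.update_eq_of_agreeOff [Fintype V] (hφ : StrategyProof φ)
    (hu : Unanimous φ) (P : V → SPPref m) (i : V) {R R' : SPPref m} {x a y : Fin m}
    (hxa : x < a) (hay : a < y) (h : AgreeOff R.1 R'.1 x y) (hR : R.peak = a)
    (hR' : R'.peak = a) : φ (Function.update P i R) = φ (Function.update P i R') := by
  have hxy : x ≠ y := (hxa.trans hay).ne
  have key : ∀ s : Finset V, i ∉ s → ∃ P' : V → SPPref m, (∀ j ∈ s, (P' j).peak = a) ∧
      (φ (Function.update P' i R)).1 x - (φ (Function.update P' i R')).1 x =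
        (φ (Function.update P i R)).1 x - (φ (Function.update P i R')).1 x := by
    intro s
    induction s using Finset.induction_on with
    | empty => exact fun _ => ⟨P, by simp, rfl⟩
    | insert j s hj ih =>
      intro hi
      rw [mem_insert, not_or] at hi
      obtain ⟨P', h1, h2⟩ := ih hi.2
      obtain ⟨T, hT, h3⟩ := hφ.exists_peak_swap_effect_eq P' (Ne.symm hi.1) hxa hay h
      refine ⟨Function.update P' j T, fun k hk => ?_, h3.trans h2⟩
      rcases eq_or_ne k j with rfl | hkj
      · rw [Function.update_self, hT]
      · rw [Function.update_of_ne hkj]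
        exact h1 k ((mem_insert.1 hk).resolve_left hkj)
  obtain ⟨P', h1, h2⟩ := key (univ.erase i) (by simp)
  -- All peaks are now at `a`, so unanimity leaves no mass on `x` before or after the swap.
  have zero : ∀ S : SPPref m, S.peak = a → (φ (Function.update P' i S)).1 x = 0 := by
    intro S hS
    refine Lottery.eq_zero_of_eq_one (hu a _ fun j => ?_) hxa.ne
    rcases eq_or_ne j i with rfl | hji
    · rw [Function.update_self, hS]
    · rw [Function.update_of_ne hji]
      exact h1 j (by simp [hji])
  rw [zero R hR, zero R' hR', sub_zero] at h2
  have off : ∀ p, p ≠ x → p ≠ y → (φ (Function.update P i R')).1 p =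
      (φ (Function.update P i R)).1 p := fun p hx hy => hφ.eq_of_agreeOff _ i h hx hy
  have g := sub_add_sub_of_eq_off hxy off
  refine Subtype.ext (funext fun p => ?_)
  rcases eq_or_ne p x with rfl | hpx
  · linarith
  rcases eq_or_ne p y with rfl | hpy
  · linarith
  exact (off p hpx hpy).symm

end TopsOnly

/-! ### Only peaks matter, and initial segments only see who peaks inside -/

section TopsOnly

variable {m : ℕ} [NeZero m]

open Classical in
/-- The pairs around the peak on which `R` disagrees with `leftFirst`. -/
noncomputable def rightAboveLeft (R : SPPref m) : Finset (Fin m × Fin m) :=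
  {z | z.1 < R.peak ∧ R.peak < z.2 ∧ R.1.r z.2 z.1}

theorem eq_leftFirst_of_rightAboveLeft_eq_empty {R : SPPref m} (h : rightAboveLeft R = ∅) :
    R = leftFirst R.peak := by
  refine (Subtype.ext (Pref.ext_of_imp fun p q hpq => ?_)).symm
  rw [leftFirst_r] at hpq
  rcases hpq with h1 | ⟨h1, h2⟩ | ⟨h1, h2⟩
  · exact SPPref.r_of_lt (Or.inr h1)
  · rcases R.1.total p q with h3 | h3
    · exact h3
    · rcases h1.eq_or_lt with rfl | h1
      · exact R.peak_le _
      · have : (p, q) ∈ rightAboveLeft R := by simp [rightAboveLeft, h1, h2, h3]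
        simp [h] at this
  · exact SPPref.r_of_lt (Or.inl ⟨h1.le, h2⟩)

/-- The order obtained from `R` by moving `x` above `y`, where `y` is ranked directly above `x`. -/
def Pref.swap (R : Pref m) (x y : Fin m) (hxy : x ≠ y) (hr : R.r y x)
    (hc : ∀ z, R.r y z → R.r z x → z = x ∨ z = y) : Pref m where
  r p q := (p = x ∧ q = y) ∨ (R.r p q ∧ ¬ (p = y ∧ q = x))
  refl p := Or.inr ⟨R.refl p, fun h => hxy (h.2.symm.trans h.1)⟩
  antisymm p q h h' := by
    rcases h with ⟨rfl, rfl⟩ | ⟨h1, h2⟩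
    · rcases h' with ⟨h3, -⟩ | ⟨-, h3⟩
      · exact h3.symm
      · exact absurd ⟨rfl, rfl⟩ h3
    · rcases h' with ⟨h3, h4⟩ | ⟨h3, -⟩
      · exact absurd ⟨h4, h3⟩ h2
      · exact R.antisymm _ _ h1 h3
  trans p q s h h' := by
    rcases h with ⟨rfl, rfl⟩ | ⟨h1, h2⟩
    · rcases h' with ⟨-, h3⟩ | ⟨h3, h4⟩
      · exact Or.inl ⟨rfl, h3⟩
      · by_cases hs : s = q
        · exact Or.inl ⟨rfl, hs⟩
        · refine Or.inr ⟨?_, fun h => hxy h.1⟩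
          rcases R.total p s with h5 | h5
          · exact h5
          · rcases hc s h3 h5 with rfl | rfl
            · exact R.refl _
            · exact absurd rfl hs
    · rcases h' with ⟨rfl, rfl⟩ | ⟨h3, h4⟩
      · by_cases hp : p = q
        · exact Or.inl ⟨hp, rfl⟩
        · refine Or.inr ⟨?_, fun h => hxy h.2.symm⟩
          rcases R.total p s with h5 | h5
          · exact h5
          · rcases hc p h5 h1 with rfl | rfl
            · exact absurd rfl hp
            · exact R.refl _
      · refine Or.inr ⟨R.trans _ _ _ h1 h3, ?_⟩
        rintro ⟨rfl, rfl⟩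
        rcases hc q h1 h3 with rfl | rfl
        · exact h2 ⟨rfl, rfl⟩
        · exact h4 ⟨rfl, rfl⟩
  total p q := by
    by_cases h1 : p = x ∧ q = y
    · exact Or.inl (Or.inl h1)
    by_cases h2 : p = y ∧ q = x
    · exact Or.inr (Or.inl h2.symm)
    rcases R.total p q with h | h
    · exact Or.inl (Or.inr ⟨h, h2⟩)
    · exact Or.inr (Or.inr ⟨h, fun h' => h1 h'.symm⟩)

theorem exists_swap {R : SPPref m} (h : (rightAboveLeft R).Nonempty) :
    ∃ x y, ∃ R' : SPPref m, x < R.peak ∧ R.peak < y ∧ R'.peak = R.peak ∧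
      AgreeOff R.1 R'.1 x y ∧ #(rightAboveLeft R') < #(rightAboveLeft R) := by
  classical
  have memiff : ∀ (S : SPPref m) p q, (p, q) ∈ rightAboveLeft S ↔
      p < S.peak ∧ S.peak < q ∧ S.1.r q p := fun S p q => by simp [rightAboveLeft]
  -- Take the rightmost `x` occurring in an inversion, then the rightmost `y` inverted with it. A
  -- project ranked between them would give an inversion with a larger coordinate, so `y` is
  -- directly above `x`.
  obtain ⟨z, hz, hzmax⟩ := Finset.exists_max_image (rightAboveLeft R) Prod.fst h
  obtain ⟨x, y₀⟩ := z
  obtain ⟨w, hw, hwmax⟩ := Finset.exists_max_image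
    ((rightAboveLeft R).filter fun z => z.1 = x) Prod.snd ⟨(x, y₀), by simp [hz]⟩
  obtain ⟨x', y⟩ := w
  rw [mem_filter] at hw
  obtain ⟨hw, rfl : x' = x⟩ := hw
  obtain ⟨hx, hy, hr⟩ := (memiff _ _ _).1 hw
  have hxy : x' ≠ y := (hx.trans hy).ne
  have hc : ∀ z, R.1.r y z → R.1.r z x' → z = x' ∨ z = y := by
    intro z h1 h2
    rcases lt_trichotomy z R.peak with h3 | h3 | h3
    · left
      have h4 : z ≤ x' := hzmax (z, y) ((memiff _ _ _).2 ⟨h3, hy, h1⟩)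
      exact R.1.antisymm _ _ h2 (SPPref.r_of_lt (Or.inr ⟨h4, hx.le⟩))
    · exact absurd (R.1.antisymm _ _ h1 (h3 ▸ R.peak_le y)) (by rw [h3]; exact hy.ne')
    · right
      have h4 : z ≤ y := hwmax (x', z) (mem_filter.2 ⟨(memiff _ _ _).2 ⟨hx, h3, h2⟩, rfl⟩)
      exact R.1.antisymm _ _ (SPPref.r_of_lt (Or.inl ⟨h3.le, h4⟩)) h1
  have htop : (R.1.swap x' y hxy hr hc).top = R.peak :=
    Pref.top_eq _ fun p => Or.inr ⟨R.peak_le p, fun h => hy.ne h.1⟩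
  let R' : SPPref m := ⟨R.1.swap x' y hxy hr hc, by
    intro p q hpq
    rw [htop] at hpq
    refine ⟨Or.inr ⟨(R.2 p q hpq).1, ?_⟩, (R.2 p q hpq).2⟩
    rintro ⟨rfl, rfl⟩
    rcases hpq with h1 | h1
    · exact absurd (h1.1.trans h1.2) (not_lt.2 hx.le)
    · exact absurd h1.2 (not_lt.2 hy.le)⟩
  refine ⟨x', y, R', hx, hy, htop, ?_, Finset.card_lt_card ?_⟩
  · intro p q h1 h2
    exact ⟨fun h => Or.inr ⟨h, h2⟩, fun h => (h.resolve_left h1).1⟩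
  · rw [Finset.ssubset_iff_of_subset]
    · refine ⟨(x', y), hw, fun h' => ?_⟩
      rcases ((memiff _ _ _).1 h').2.2 with h1 | h1
      · exact hxy h1.1.symm
      · exact h1.2 ⟨rfl, rfl⟩
    · rintro ⟨p, q⟩ hpq
      obtain ⟨h1, h2, h3⟩ := (memiff _ _ _).1 hpq
      rw [show R'.peak = R.peak from htop] at h1 h2
      refine (memiff _ _ _).2 ⟨h1, h2, ?_⟩
      rcases h3 with h3 | h3
      · exact absurd (h1.trans h2) (by rw [h3.1, h3.2]; exact not_lt.2 (hx.trans hy).le)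
      · exact h3.1

variable {V : Type*} [Fintype V] [DecidableEq V] {φ : RSCR V m}

/-- Bubble sort: each swap keeps the peak and the lottery and lowers the number of inversions. -/
theorem StrategyProof.update_eq_leftFirst (hφ : StrategyProof φ) (hu : Unanimous φ)
    (P : V → SPPref m) (i : V) (R : SPPref m) :
    φ (Function.update P i R) = φ (Function.update P i (leftFirst R.peak)) := by
  induction hN : #(rightAboveLeft R) using Nat.strong_induction_on generalizing R with
  | _ N ih =>
    rcases (rightAboveLeft R).eq_empty_or_nonempty with h | h
    · rw [← eq_leftFirst_of_rightAboveLeft_eq_empty h]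
    · obtain ⟨x, y, R', hx, hy, hp, hag, hlt⟩ := exists_swap h
      rw [hφ.update_eq_of_agreeOff hu P i hx hy hag rfl hp, ih _ (hN ▸ hlt) R' rfl, hp]

theorem StrategyProof.update_eq_of_peak_eq (hφ : StrategyProof φ) (hu : Unanimous φ)
    (P : V → SPPref m) (i : V) {R R' : SPPref m} (h : R.peak = R'.peak) :
    φ (Function.update P i R) = φ (Function.update P i R') := by
  rw [hφ.update_eq_leftFirst hu P i R, h, ← hφ.update_eq_leftFirst hu P i R']

theorem leftFirst_isUpper_initial {a : Fin m} {t : ℕ} (h : (a : ℕ) < t) :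
    (leftFirst a).1.IsUpper ({p : Fin m | (p : ℕ) < t} : Finset (Fin m)) := by
  intro p hp s hs
  rw [leftFirst_r] at hs
  simp only [mem_filter, mem_univ, true_and, Fin.le_def, Fin.lt_def] at *
  omega

theorem rightFirst_isUpper_final {a : Fin m} {t : ℕ} (h : ¬ (a : ℕ) < t) :
    (rightFirst a).1.IsUpper ({p : Fin m | ¬ (p : ℕ) < t} : Finset (Fin m)) := by
  intro p hp s hs
  rw [rightFirst_r] at hs
  simp only [mem_filter, mem_univ, true_and, Fin.le_def, Fin.lt_def] at *
  omega

/-- Since only peaks matter, both reports may be taken as `leftFirst` when the peaks are inside the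
segment, which is then upper for both, and as `rightFirst` when they are outside, where the
complement is upper for both. -/
theorem StrategyProof.cum_update_eq (hφ : StrategyProof φ) (hu : Unanimous φ)
    (P : V → SPPref m) (i : V) {R R' : SPPref m} {t : ℕ}
    (h : (R.peak : ℕ) < t ↔ (R'.peak : ℕ) < t) :
    cum (φ (Function.update P i R)) t = cum (φ (Function.update P i R')) t := by
  by_cases ht : (R'.peak : ℕ) < t
  · rw [hφ.update_eq_leftFirst hu P i R, hφ.update_eq_leftFirst hu P i R']
    exact hφ.sum_eq P i (leftFirst_isUpper_initial ht) (leftFirst_isUpper_initial (h.2 ht))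
  · rw [hφ.update_eq_of_peak_eq hu P i (peak_rightFirst R.peak).symm,
      hφ.update_eq_of_peak_eq hu P i (peak_rightFirst R'.peak).symm]
    have h1 := hφ.sum_eq P i (rightFirst_isUpper_final ht)
      (rightFirst_isUpper_final (mt h.1 ht))
    have h2 := cum_add_compl (φ (Function.update P i (rightFirst R.peak))) t
    have h3 := cum_add_compl (φ (Function.update P i (rightFirst R'.peak))) t
    linarith

theorem StrategyProof.cum_eq (hφ : StrategyProof φ) (hu : Unanimous φ) {P P' : V → SPPref m}
    {t : ℕ} (h : ∀ i, ((P i).peak : ℕ) < t ↔ ((P' i).peak : ℕ) < t) :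
    cum (φ P) t = cum (φ P') t := by
  have key : ∀ s : Finset V, cum (φ (s.piecewise P' P)) t = cum (φ P) t := by
    intro s
    induction s using Finset.induction_on with
    | empty => rw [Finset.piecewise_empty]
    | insert j s hj ih =>
      rw [← ih, Finset.piecewise_insert]
      conv_rhs => rw [← Function.update_eq_self j (s.piecewise P' P)]
      refine hφ.cum_update_eq hu _ j ?_
      rw [Finset.piecewise_eq_of_notMem _ _ _ hj]
      exact (h j).symm
  rw [← key univ, Finset.piecewise_univ]

end TopsOnly

/-! ### Peak counts by group and ballots from extreme profiles -/

section Ballots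

variable {V G : Type*} [Fintype V] [DecidableEq G] {grp : V → G}

/-- The position of a voter in an enumeration of their group. -/
noncomputable def groupIndex (grp : V → G) (i : V) : ℕ :=
  (Fintype.equivFin (Members grp (grp i)) ⟨i, rfl⟩ : ℕ)

theorem groupIndex_eq {q : G} (i : Members grp q) :
    groupIndex grp i = (Fintype.equivFin (Members grp q) i : ℕ) := by
  obtain ⟨i, rfl⟩ := i
  rfl

theorem groupIndex_lt (i : V) : groupIndex grp i < Fintype.card (Members grp (grp i)) :=
  Fin.is_lt _

theorem card_groupIndex_lt {q : G} {k : ℕ} (hk : k ≤ Fintype.card (Members grp q)) :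
    #{i : Members grp q | groupIndex grp i < k} = k := by
  simp only [groupIndex_eq]
  rw [← Finset.card_map (Fintype.equivFin (Members grp q)).toEmbedding, Finset.map_filter]
  simp only [Function.comp_def, Equiv.apply_symm_apply, Finset.map_univ_equiv]
  rw [Fin.card_filter_val_lt, min_eq_right hk]

theorem alpha_eq_of_groupIndex {m : ℕ} [NeZero m] {P : V → SPPref m} {γ : Gam grp} {t : ℕ}
    (h : ∀ i, ((P i).peak : ℕ) < t ↔ groupIndex grp i < γ.1 (grp i)) : alpha grp t P = γ := by
  refine Subtype.ext (funext fun q => Eq.trans (congrArg card (Finset.ext fun i => ?_))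
    (card_groupIndex_lt (γ.2 q)))
  obtain ⟨i, rfl⟩ := i
  exact ⟨fun hi => mem_filter.2 ⟨mem_univ _, (h i).1 (mem_filter.1 hi).2⟩,
    fun hi => mem_filter.2 ⟨mem_univ _, (h i).2 (mem_filter.1 hi).2⟩⟩

/-- Within each group, equal counts allow matching `A` with `B` and the complements with each other;
the matchings glue along the fibres of `grp`. This is how anonymity reduces a set of voters to its
group counts. -/
theorem exists_groupPerm {A B : V → Prop} [DecidablePred A] [DecidablePred B]
    (h : ∀ q, #{i : Members grp q | A i} = #{i : Members grp q | B i}) :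
    ∃ π : Equiv.Perm V, (∀ i, grp (π i) = grp i) ∧ ∀ i, B (π i) ↔ A i := by
  have key : ∀ q, ∃ e : Equiv.Perm (Members grp q), ∀ i, B (e i) ↔ A i := by
    intro q
    have h1 : Fintype.card {i : Members grp q // A i} = Fintype.card {i : Members grp q // B i} := by
      rw [Fintype.card_subtype, Fintype.card_subtype, h q]
    have h2 := Fintype.card_compl_eq_card_compl _ _ h1
    refine ⟨Equiv.subtypeCongr (Fintype.equivOfCardEq h1) (Fintype.equivOfCardEq h2), fun i => ?_⟩
    by_cases hi : A i
    · simp only [hi, iff_true, Equiv.subtypeCongr, Equiv.trans_apply, Equiv.sumCompl_symm_apply_of_pos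
        (p := fun i : Members grp q => A i) hi]
      exact (Fintype.equivOfCardEq h1 ⟨i, hi⟩).2
    · simp only [hi, iff_false, Equiv.subtypeCongr, Equiv.trans_apply, Equiv.sumCompl_symm_apply_of_neg
        (p := fun i : Members grp q => A i) hi]
      exact (Fintype.equivOfCardEq h2 ⟨i, hi⟩).2
  choose e he using key
  refine ⟨((Equiv.sigmaFiberEquiv grp).symm.trans (Equiv.sigmaCongrRight e)).trans
    (Equiv.sigmaFiberEquiv grp), fun i => (e (grp i) ⟨i, rfl⟩).2, fun i => he (grp i) ⟨i, rfl⟩⟩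

variable {m : ℕ} [NeZero m]

variable (m) in
/-- The extreme profile in which, of each group `q`, `γ q` members have the first project as their
peak and all others the last. -/
noncomputable def extremeProfile (γ : G → ℕ) (grp : V → G) (i : V) : SPPref m :=
  if groupIndex grp i < γ (grp i) then leftFirst ⟨0, Nat.pos_of_neZero m⟩
  else leftFirst ⟨m - 1, Nat.sub_one_lt (NeZero.ne m)⟩

/-- The bounds on `t` matter: only a nonempty proper initial segment contains the first project and
misses the last. -/
theorem alpha_extremeProfile (γ : Gam grp) {t : ℕ} (h0 : 0 < t) (hm : t < m) :
    alpha grp t (extremeProfile m γ.1 grp) = γ := by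
  refine alpha_eq_of_groupIndex fun i => ?_
  rw [extremeProfile]
  split_ifs with h <;> simp only [peak_leftFirst, h, iff_true, iff_false] <;> omega

variable [DecidableEq V] {φ : RSCR V m}

theorem StrategyProof.cum_eq_of_alpha_eq (hφ : StrategyProof φ) (hu : Unanimous φ)
    (ha : GroupAnonymous grp φ) {P P' : V → SPPref m} {t : ℕ}
    (h : alpha grp t P = alpha grp t P') : cum (φ P) t = cum (φ P') t := by
  obtain ⟨π, h1, h2⟩ := exists_groupPerm (grp := grp) (A := fun i => ((P i).peak : ℕ) < t)
    (B := fun i => ((P' i).peak : ℕ) < t) fun q => congrFun (congrArg Subtype.val h) q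
  rw [ha π h1 P']
  exact hφ.cum_eq hu fun i => (h2 i).symm

theorem StrategyProof.cum_extremeProfile (hφ : StrategyProof φ) (hu : Unanimous φ)
    (ha : GroupAnonymous grp φ) (P : V → SPPref m) (t : ℕ) :
    cum (φ (extremeProfile m (alpha grp t P).1 grp)) t = cum (φ P) t := by
  rcases Nat.eq_zero_or_pos t with rfl | h0
  · rw [cum_zero, cum_zero]
  rcases le_or_gt m t with hm | hm
  · rw [cum_of_le _ hm, cum_of_le _ hm]
  exact hφ.cum_eq_of_alpha_eq hu ha (alpha_extremeProfile _ h0 hm)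

theorem StrategyProof.cum_extremeProfile_mono (hφ : StrategyProof φ) {γ γ' : G → ℕ}
    (h : γ' ≤ γ) (t : ℕ) :
    cum (φ (extremeProfile m γ' grp)) t ≤ cum (φ (extremeProfile m γ grp)) t := by
  rcases Nat.eq_zero_or_pos t with rfl | h0
  · rw [cum_zero, cum_zero]
  have key : ∀ s : Finset V, cum (φ (extremeProfile m γ' grp)) t ≤
      cum (φ (s.piecewise (extremeProfile m γ grp) (extremeProfile m γ' grp))) t := by
    intro s
    induction s using Finset.induction_on with
    | empty => rw [Finset.piecewise_empty]
    | insert j s hj ih =>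
      refine ih.trans ?_
      rw [Finset.piecewise_insert]
      conv_lhs => rw [← Function.update_eq_self j
        (s.piecewise (extremeProfile m γ grp) (extremeProfile m γ' grp))]
      rw [Finset.piecewise_eq_of_notMem _ _ _ hj]
      by_cases h1 : groupIndex grp j < γ (grp j)
      · rw [show extremeProfile m γ grp j = leftFirst _ from if_pos h1]
        exact hφ.sum_le _ j _ (leftFirst_isUpper_initial h0)
      · have h2 : ¬ groupIndex grp j < γ' (grp j) := fun h' => h1 (h'.trans_le (h _))
        rw [extremeProfile, extremeProfile, if_neg h1, if_neg h2]
  simpa only [Finset.piecewise_univ] using key univ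

theorem StrategyProof.isPFGBRWith (hφ : StrategyProof φ) (hu : Unanimous φ)
    (ha : GroupAnonymous grp φ) :
    IsPFGBRWith grp φ fun γ => φ (extremeProfile m γ.1 grp) where
  unanimity_bot p hp := by
    refine hu p _ fun i => ?_
    rw [extremeProfile, if_neg (by exact Nat.not_lt_zero _), peak_leftFirst]
    ext
    simp only; omega
  unanimity_top p hp := by
    refine hu p _ fun i => ?_
    rw [extremeProfile, if_pos (by exact groupIndex_lt i), peak_leftFirst]
    ext
    simp only; omega
  monotone γ γ' h t _ _ := hφ.cum_extremeProfile_mono h t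
  prob P p := by
    rw [hφ.cum_extremeProfile hu ha, hφ.cum_extremeProfile hu ha, cum_succ]
    ring

end Ballots

/-! ### Cumulative probabilities, representative intervals and peak counts -/

variable {m : ℕ}

theorem cum_add_sum_Icc (d : Lottery m) {u v : Fin m} (h : u ≤ v) :
    cum d u + ∑ p ∈ Icc u v, d.1 p = cum d (v + 1) := by
  unfold cum
  rw [← Finset.sum_union]
  · congr 1
    ext q
    simp only [mem_union, mem_filter, mem_univ, true_and, mem_Icc, Fin.le_def] at *
    omega
  · rw [Finset.disjoint_left]
    intro q
    simp only [mem_filter, mem_univ, true_and, mem_Icc, Fin.le_def]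
    omega

theorem cum_eq_zero {d : Lottery m} {p : Fin m} (h : d.1 p = 1) {t : ℕ} (ht : t ≤ p) :
    cum d t = 0 := by
  refine Finset.sum_eq_zero fun q hq => Lottery.eq_zero_of_eq_one h ?_
  rintro rfl
  exact absurd (mem_filter.1 hq).2 (not_lt.2 ht)

theorem cum_eq_one {d : Lottery m} {p : Fin m} (h : d.1 p = 1) {t : ℕ} (ht : (p : ℕ) < t) :
    cum d t = 1 := by
  unfold cum
  rw [Finset.sum_eq_single_of_mem p (by simp [ht])
    fun q _ hq => Lottery.eq_zero_of_eq_one h hq, h]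

variable {V G : Type*} {grp : V → G} [NeZero m]

theorem Compliant.exists_least {κ : G → ℕ} {ψ : RepScenario grp m} (hψ : Compliant grp κ ψ)
    {q : G} (hκ : 1 ≤ κ q) (Q : Members grp q → SPPref m) :
    ∃ x : Fin m, IsLeast (ψ q Q : Set (Fin m)) x ∧ (x : ℕ) + κ q ≤ m ∧
      ∀ p : Fin m, p ∈ ψ q Q ↔ ((x : ℕ) ≤ p ∧ (p : ℕ) < x + κ q) := by
  obtain ⟨⟨a, b, hab⟩, hc⟩ := (hψ q).2 Q
  have hb := b.2
  rw [hab, Fin.card_Icc] at hc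
  rw [hab]
  refine ⟨a, ⟨?_, fun p hp => ?_⟩, by omega, fun p => ?_⟩
  · rw [mem_coe, mem_Icc, Fin.le_def, Fin.le_def]
    omega
  · exact (mem_Icc.1 (mem_coe.1 hp)).1
  · rw [mem_Icc, Fin.le_def, Fin.le_def]
    omega

variable [Fintype V] [DecidableEq G]

theorem alpha_of_le {t : ℕ} (P : V → SPPref m) (h : ∀ i, ((P i).peak : ℕ) < t) :
    alpha grp t P = gamTop grp :=
  Subtype.ext (funext fun q => by simp [alpha, countUpTo, gamTop, restrict, h, Finset.card_univ])

theorem alpha_of_ge {t : ℕ} (P : V → SPPref m) (h : ∀ i, ¬ ((P i).peak : ℕ) < t) :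
    alpha grp t P = gamBot grp :=
  Subtype.ext (funext fun q => by simp only [alpha, countUpTo, gamBot, restrict, h]; simp)

theorem alpha_le_alpha {s t : ℕ} {P P' : V → SPPref m}
    (h : ∀ i, ((P i).peak : ℕ) < s → ((P' i).peak : ℕ) < t) : alpha grp s P ≤ alpha grp t P' :=
  fun _ => Finset.card_le_card fun _ hi =>
    mem_filter.2 ⟨mem_univ _, h _ (mem_filter.1 hi).2⟩

theorem alpha_comp_perm {π : Equiv.Perm V} (hπ : ∀ i, grp (π i) = grp i) (t : ℕ)
    (P : V → SPPref m) : alpha grp t (fun i => P (π i)) = alpha grp t P := by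
  refine Subtype.ext (funext fun q => ?_)
  refine Finset.card_bij (fun i _ => ⟨π i.1, (hπ i.1).trans i.2⟩) ?_ ?_ ?_
  · intro i hi
    exact mem_filter.2 ⟨mem_univ _, (mem_filter.1 hi).2⟩
  · intro i _ j _ h
    exact Subtype.ext (π.injective (congrArg Subtype.val h))
  · rintro ⟨i, hq⟩ hi
    refine ⟨⟨π.symm i, ?_⟩, mem_filter.2 ⟨mem_univ _, ?_⟩, Subtype.ext (π.apply_symm_apply i)⟩
    · rw [← hπ, π.apply_symm_apply, hq]
    · have := (mem_filter.1 hi).2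
      simpa [restrict] using this

/-! ### Ballot rules satisfy the axioms -/

namespace IsPFGBRWith

variable {φ : RSCR V m} {δ : Gam grp → Lottery m}

theorem cum_eq (h : IsPFGBRWith grp φ δ) (P : V → SPPref m) {t : ℕ} (ht : t ≤ m) :
    cum (φ P) t = cum (δ (alpha grp t P)) t := by
  induction t with
  | zero => rw [cum_zero, cum_zero]
  | succ t ih =>
    have h1 := cum_succ (φ P) ⟨t, ht⟩
    have h2 := h.prob P ⟨t, ht⟩
    have h3 := ih (by omega)
    simp only at h1 h2
    linarith

theorem cum_mono (h : IsPFGBRWith grp φ δ) {γ γ' : Gam grp} (hγ : γ' ≤ γ) {t : ℕ} (ht : t ≤ m) :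
    cum (δ γ') t ≤ cum (δ γ) t := by
  rcases Nat.eq_zero_or_pos t with rfl | h0
  · rw [cum_zero, cum_zero]
  · exact h.monotone γ γ' hγ t h0 ht

theorem unanimous (h : IsPFGBRWith grp φ δ) : Unanimous φ := by
  intro p P hP
  have h0 := Nat.pos_of_neZero m
  rw [h.prob, alpha_of_le P (by simp [hP]), alpha_of_ge P (by simp [hP]),
    cum_eq_one (h.unanimity_top ⟨0, h0⟩ rfl) (Nat.succ_pos _),
    cum_eq_zero (h.unanimity_bot ⟨m - 1, by omega⟩ (by simp only; omega)) (by simp only; omega),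
    sub_zero]

/-- An upper contour set is an interval `[u, v]` containing the peak, with mass `cum (v + 1) - cum
u`. A misreport can only add a peak before `u` and remove one at or before `v`; by monotone ballots
both lower this difference. -/
theorem strategyProof [DecidableEq V] (h : IsPFGBRWith grp φ δ) : StrategyProof φ := by
  classical
  intro i P R' p
  obtain ⟨u, hu, hmin⟩ := (P i).1.exists_min_contour p
  obtain ⟨v, hv, hmax⟩ := (P i).1.exists_max_contour p
  have hIcc : ∀ d : Lottery m, upperProb (P i) d p = ∑ p ∈ Icc u v, d.1 p := by
    intro d
    unfold upperProb
    congr 1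
    ext s
    rw [mem_filter, mem_Icc]
    exact ⟨fun hs => ⟨hmin s hs.2, hmax s hs.2⟩,
      fun hs => ⟨mem_univ _, (P i).r_of_between hu hv hs.1 hs.2⟩⟩
  have hua := hmin _ ((P i).peak_le p)
  have hav := hmax _ ((P i).peak_le p)
  rw [hIcc, hIcc]
  have e1 := cum_add_sum_Icc (φ P) (hua.trans hav)
  have e2 := cum_add_sum_Icc (φ (Function.update P i R')) (hua.trans hav)
  rw [h.cum_eq _ u.2.le, h.cum_eq _ (Nat.succ_le_of_lt v.2)] at e1 e2
  have m1 : cum (δ (alpha grp u P)) u ≤ cum (δ (alpha grp u (Function.update P i R'))) u := by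
    refine h.cum_mono (alpha_le_alpha fun j hj => ?_) u.2.le
    rcases eq_or_ne j i with rfl | hji
    · exact absurd hj (not_lt.2 hua)
    · rwa [Function.update_of_ne hji]
  have m2 : cum (δ (alpha grp (v + 1) (Function.update P i R'))) (v + 1) ≤
      cum (δ (alpha grp (v + 1) P)) (v + 1) := by
    refine h.cum_mono (alpha_le_alpha fun j hj => ?_) (Nat.succ_le_of_lt v.2)
    rcases eq_or_ne j i with rfl | hji
    · exact Nat.lt_succ_of_le hav
    · rwa [Function.update_of_ne hji] at hj
  linarith

theorem groupAnonymous (h : IsPFGBRWith grp φ δ) : GroupAnonymous grp φ := by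
  intro π hπ P
  refine Subtype.ext (funext fun p => ?_)
  rw [h.prob, h.prob, alpha_comp_perm hπ, alpha_comp_perm hπ]

end IsPFGBRWith

/-! ### Prescribed peak counts and the entitlement guarantee -/

/-- Every monotone path of vectors from the zero vector at `0` to the vector of group sizes at `m`
is the path of peak counts of a profile. -/
theorem exists_profile_alpha_eq {g : ℕ → Gam grp} (hg : Monotone g) (h0 : g 0 = gamBot grp)
    (hm : g m = gamTop grp) : ∃ P : V → SPPref m, ∀ t, alpha grp t P = g t := by
  classical
  -- The peak of `i` is the first project at which the path's count for the group exceeds the index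
  -- of `i`.
  have key : ∀ i : V, ∃ t, groupIndex grp i < (g (t + 1)).1 (grp i) := by
    intro i
    refine ⟨m - 1, ?_⟩
    rw [Nat.sub_add_cancel (Nat.pos_of_neZero m), hm]
    exact groupIndex_lt i
  have find_lt_iff : ∀ i t, Nat.find (key i) < t ↔ groupIndex grp i < (g t).1 (grp i) := by
    intro i t
    rw [Nat.find_lt_iff]
    constructor
    · rintro ⟨s, hst, hs⟩
      exact hs.trans_le (hg hst _)
    · intro h
      cases t with
      | zero => rw [h0] at h; exact absurd h (Nat.not_lt_zero _)
      | succ t => exact ⟨t, Nat.lt_succ_self t, h⟩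
  have find_lt : ∀ i, Nat.find (key i) < m := fun i => by
    rw [find_lt_iff i m, hm]
    exact groupIndex_lt i
  refine ⟨fun i => leftFirst ⟨Nat.find (key i), find_lt i⟩, fun t => ?_⟩
  refine alpha_eq_of_groupIndex fun i => ?_
  rw [peak_leftFirst]
  exact find_lt_iff i t

/-- The values `x + j = 0` and `x + j ≥ m` are excluded because counts there are forced to be
extreme, whereas `γ j` need not be in the other groups. No information is lost: `cum` is then `0` or
`1` for every lottery. -/
theorem exists_profile_restrict_eq {q : G} {k : ℕ} {γ : Fin (k + 1) → Gam grp} (hγ : Monotone γ)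
    {x : ℕ} (Q : Members grp q → SPPref m)
    (hQ : ∀ j : Fin (k + 1), countUpTo (x + j) Q = (γ j).1 q) :
    ∃ P : V → SPPref m, restrict grp P q = Q ∧
      ∀ j : Fin (k + 1), x + j ≠ 0 → x + j < m → alpha grp (x + j) P = γ j := by
  classical
  let g : ℕ → Gam grp := fun t =>
    if t = 0 ∨ t < x then gamBot grp
    else if h : t < m ∧ t - x < k + 1 then γ ⟨t - x, h.2⟩ else gamTop grp
  have hbot : ∀ a : Gam grp, gamBot grp ≤ a := fun _ _ => Nat.zero_le _
  have htop : ∀ a : Gam grp, a ≤ gamTop grp := fun a q => a.2 q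
  have hg : Monotone g := by
    intro s t hst
    by_cases h1 : s = 0 ∨ s < x
    · simp only [g, if_pos h1]
      exact hbot _
    have h2 : ¬ (t = 0 ∨ t < x) := by omega
    by_cases h3 : t < m ∧ t - x < k + 1
    · have h4 : s < m ∧ s - x < k + 1 := by omega
      simp only [g, if_neg h1, if_neg h2, dif_pos h3, dif_pos h4]
      exact hγ (by simp only [Fin.le_def]; omega)
    · simp only [g, if_neg h2, dif_neg h3]
      exact htop _
  have h0 : g 0 = gamBot grp := by simp [g]
  obtain ⟨P₀, hP₀⟩ : ∃ P : V → SPPref m, ∀ t < m, alpha grp t P = g t := by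
    -- The cut-off at `m` is needed since `g m` is still `gamBot` when `x > m`.
    obtain ⟨P, hP⟩ := exists_profile_alpha_eq (m := m)
      (g := fun t => if t < m then g t else gamTop grp) (by
        intro s t hst
        simp only
        by_cases h : t < m
        · rw [if_pos h, if_pos (hst.trans_lt h)]
          exact hg hst
        · rw [if_neg h]
          exact htop _)
      (by rw [if_pos (Nat.pos_of_neZero m), h0]) (by rw [if_neg (lt_irrefl m)])
    exact ⟨P, fun t ht => by rw [hP t, if_pos ht]⟩
  -- Counts are computed group by group, so replacing the reports of group `q` by `Q` leaves the
  -- other coordinates intact.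
  let P : V → SPPref m := fun i => if h : grp i = q then Q ⟨i, h⟩ else P₀ i
  have hP : restrict grp P q = Q := funext fun i => by
    simp only [restrict, P, dif_pos i.2]
  refine ⟨P, hP, fun j hj hjm => Subtype.ext (funext fun q' => ?_)⟩
  by_cases hq : q' = q
  · subst hq
    simp only [alpha, hP, hQ]
  · have h1 : restrict grp P q' = restrict grp P₀ q' := funext fun i => by
      have : grp i.1 ≠ q := fun h => hq (i.2.symm.trans h)
      simp only [restrict, P, dif_neg this]
    have h2 : g (x + j) = γ j := by
      have h3 : ¬ (x + (j : ℕ) = 0 ∨ x + (j : ℕ) < x) := by omega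
      have h4 : x + (j : ℕ) < m ∧ x + (j : ℕ) - x < k + 1 := ⟨hjm, by omega⟩
      simp only [g, if_neg h3, dif_pos h4]
      congr 1
      ext
      simp
    rw [← h2, ← hP₀ _ hjm]
    simp only [alpha, h1]

/-- For the representative `p = x + t`, the ballot difference at `t` is the probability of `p` at a
profile whose counts follow the chain. -/
theorem IsPFGBRWith.strongGEG_iff {κ : G → ℕ} (hκ : ∀ q, 1 ≤ κ q) {η : G → ℝ}
    {ψ : RepScenario grp m} (hψ : Compliant grp κ ψ) {φ : RSCR V m} {δ : Gam grp → Lottery m}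
    (h : IsPFGBRWith grp φ δ) :
    StrongGEG grp ψ η φ ↔
      ∀ (q : G) (γ : Fin (κ q + 1) → Gam grp), Monotone γ →
        ∀ x : Fin m, Feasible (ψ q) (κ q) x (fun j => (γ j).1 q) →
          ∃ t : Fin (κ q), η q ≤ cum (δ (γ t.succ)) ((x : ℕ) + t + 1)
            - cum (δ (γ t.castSucc)) ((x : ℕ) + t) := by
  constructor
  · rintro hG q γ hγ x ⟨-, Q, hx, hQ⟩
    obtain ⟨P, rfl, hP⟩ := exists_profile_restrict_eq hγ Q hQ
    obtain ⟨p, hp, hη⟩ := hG P q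
    obtain ⟨x', hx', -, hmem⟩ := hψ.exists_least (hκ q) (restrict grp P q)
    obtain rfl := hx.unique hx'
    obtain ⟨h1, h2⟩ := (hmem p).1 hp
    refine ⟨⟨p - x, by omega⟩, ?_⟩
    rw [h.prob] at hη
    have e : (x : ℕ) + (p - x) = p := by omega
    simp only [e]
    have e1 : cum (δ (γ (Fin.succ ⟨p - x, by omega⟩))) (p + 1) =
        cum (δ (alpha grp (p + 1) P)) (p + 1) := by
      -- At the last project the ballots may differ, but both cumulative probabilities are one.
      rcases le_or_gt m (p + 1) with hm | hm
      · rw [cum_of_le _ hm, cum_of_le _ hm]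
      · have := hP (Fin.succ ⟨p - x, by omega⟩) (by simp) (by simp only [Fin.val_succ]; omega)
        rw [← this, Fin.val_succ]
        congr 3
        simp only; omega
    have e2 : cum (δ (γ (Fin.castSucc ⟨p - x, by omega⟩))) p = cum (δ (alpha grp p P)) p := by
      rcases Nat.eq_zero_or_pos (p : ℕ) with h0 | h0
      · have h3 : ∀ d : Lottery m, cum d p = 0 := fun d => by rw [h0, cum_zero]
        rw [h3, h3]
      · have := hP (Fin.castSucc ⟨p - x, by omega⟩) (by simp only [Fin.val_castSucc]; omega)
          (by simp only [Fin.val_castSucc]; omega)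
        rw [← this, Fin.val_castSucc]
        congr 3
    rw [e1, e2]
    exact hη
  · intro hc P q
    obtain ⟨x, hx, hxm, hmem⟩ := hψ.exists_least (hκ q) (restrict grp P q)
    -- The chain to test is that of the profile's own peak counts, feasible through its restriction
    -- to `q`.
    obtain ⟨t, ht⟩ := hc q (fun j => alpha grp (x + j) P)
      (fun i j hij => alpha_le_alpha fun _ hk => by
        rw [Fin.le_def] at hij
        omega)
      x ⟨hxm, _, hx, fun j => rfl⟩
    refine ⟨⟨x + t, by omega⟩, (hmem _).2 (by simp only; omega), ?_⟩
    rw [h.prob]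
    exact ht

end GroupFair

theorem mainTheorem5 {V G : Type*} [Fintype V] [DecidableEq V] [Fintype G] [DecidableEq G]
    (hn : 2 ≤ Fintype.card V) (m : ℕ) [NeZero m] (grp : V → G)
    (κ : G → ℕ) (hκ : ∀ q, 1 ≤ κ q ∧ κ q ≤ m)
    (η : G → ℝ) (hη : ∀ q, 0 ≤ η q ∧ η q ≤ 1)
    (ψ : GroupFair.RepScenario grp m) (hψ : GroupFair.Compliant grp κ ψ)
    (φ : GroupFair.RSCR V m) :
    (GroupFair.Unanimous φ ∧ GroupFair.StrategyProof φ ∧ GroupFair.GroupAnonymous grp φ ∧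
        GroupFair.StrongGEG grp ψ η φ) ↔
      ∃ δ : GroupFair.Gam grp → GroupFair.Lottery m,
        GroupFair.IsPFGBRWith grp φ δ ∧
        ∀ (q : G) (γ : Fin (κ q + 1) → GroupFair.Gam grp), Monotone γ →
          ∀ x : Fin m, GroupFair.Feasible (ψ q) (κ q) x (fun j => (γ j).1 q) →
            ∃ t : Fin (κ q),
              η q ≤ GroupFair.cum (δ (γ t.succ)) ((x : ℕ) + t + 1)
                - GroupFair.cum (δ (γ t.castSucc)) ((x : ℕ) + t) := by
  constructor
  · rintro ⟨hu, hs, ha, hG⟩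
    have h := hs.isPFGBRWith hu ha
    exact ⟨_, h, (h.strongGEG_iff (fun q => (hκ q).1) hψ).1 hG⟩
  · rintro ⟨δ, h, hG⟩
    exact ⟨h.unanimous, h.strategyProof, h.groupAnonymous,
      (h.strongGEG_iff (fun q => (hκ q).1) hψ).2 hG⟩
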